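/- **Setting.** Fix $d$ and real polynomials $q_1(n,k)$, $q_2(n,k)$. Let $\mathscr K:[-1,1]^d\times[-1,1]^d\to\mathbb R$ be a kernel. Let $\overline X,\overline Y\subset[-1,1]^d$ be tensor grids of Chebyshev nodes of the first kind, with any positive number of nodes in each direction ($m$ nodes in one direction are $\cos\frac{(2k-1)\pi}{2m}$, $k=1,\dots,m$, with weights $\frac{\pi}{m}\sin\frac{(2k-1)\pi}{2m}$; weights on the tensor grid are products). Let $S_k$, $T_l$ be the tensor Lagrange basis functions of the two grids, and suppose that $$\Big|\mathscr K(x,y)-\sum_{k,l}S_k(x)\,\mathscr K(\bar x_k,\bar y_l)\,T_l(y)\Big|\le\delta\qquad\text{for all }x,y\in[-1,1]^d .$$ Put $K_w=\mathrm{diag}(\overline W_X)^{1/2}\,\mathscr K(\overline X,\overline Y)\,\mathrm{diag}(\overline W_Y)^{1/2}$ and $r_0=\max(|\overline X|,|\overline Y|)$. Singular values $\sigma_1\ge\sigma_2\ge\cdots$ are continued by $0$. **Strong RRQR.** A strong rank-revealing QR factorization of rank $k$ of a matrix $A$ with $n$ columns is a factorization $A\Pi=QR$, with $\Pi$ a permutation,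 $Q$ orthogonal, $R=\begin{bmatrix}R_{11}&R_{12}\\0&R_{22}\end{bmatrix}$ upper triangular and $R_{11}\in\mathbb R^{k\times k}$ invertible, such that, with $A_1$ the first $k$ columns of $A\Pi$ (the pivot columns), $T=R_{11}^{-1}R_{12}$ and $E=A\Pi-A_1[\,I\;\;T\,]$, $$\sigma_i(A_1)\,q_1(n,k)\ge\sigma_i(A)\ (1\le i\le k),\qquad \sigma_j(E)\le q_1(n,k)\,\sigma_{k+j}(A)\ (j\ge1),\qquad \|T\|_F\le q_2(n,k).$$ **Pivots.** Let $\widehat Y\subset\overline Y$, $|\widehat Y|=r_1$, be the pivot columns of a strong RRQR of $K_w$ with error $E_y$, and let $\widehat X\subset\overline X$, $|\widehat X|=r_1$, be selected in one of the following two ways. 1. $\widehat X$ consists of the pivots of a strong RRQR of rank $r_1$ of $K_w(\overline X,\widehat Y)^\top$ (two successive factorizations). Put $\varepsilon=\|E_y\|_2$. 2. $\widehat X$ consists of the pivots of a strong RRQR of rank $r_1$ of $K_w^\top$ with error $E_x$, and the core $\widehat K_w=K_w(\widehat X,\widehat Y)$ inherits the lower bound $\sigma_i(\widehat K_w)\,q_1(r_0,r_1)\ge\sigma_i(K_w)$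 for $1\le i\le r_1$. Put $\varepsilon=\max(\|E_x\|_2,\|E_y\|_2)$. Assume $\delta\le\varepsilon$. **Theorem.** There are polynomials $r(r_0,r_1)$, $r'(r_0,r_1)$ and a constant $C$, depending only on $d$, $q_1$, $q_2$ (not on $\mathscr K$, the grids, $r_1$, $\delta$, $\varepsilon$ or the pivots), such that in every such situation $\mathscr K(\widehat X,\widehat Y)$ is invertible and for all $x,y\in[-1,1]^d$ $$\big|\mathscr K(x,y)-\mathscr K(x,\widehat Y)\,\mathscr K(\widehat X,\widehat Y)^{-1}\,\mathscr K(\widehat X,y)\big|\le C\,\varepsilon\,r(r_0,r_1),$$ $$\big|\mathscr K(x,y)-\mathscr K(x,\widehat Y)\,\mathscr K(\widehat X,\widehat Y)^{-1}\,\mathscr K(\widehat X,y)\big|\le C\,\sigma_{r_1+1}(K_w)\,r'(r_0,r_1).$$ -/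

import Mathlib

open scoped Matrix Matrix.Norms.L2Operator

noncomputable section

namespace SkelInterp

/-! ### Chebyshev tensor grids, weights and interpolation on `[-1,1]^d` -/

/-- The `m` Chebyshev nodes of the first kind, `cos ((2k-1)π/(2m))` for `k = 1, …, m`
(here the index `k : Fin m` is zero-based). -/
def chebNode (m : ℕ) (k : Fin m) : ℝ :=
  Real.cos ((2 * (k : ℝ) + 1) / (2 * (m : ℝ)) * Real.pi)

/-- The associated integration weights `(π/m) sin ((2k-1)π/(2m))` for the measure `dx`. -/
def chebWeight (m : ℕ) (k : Fin m) : ℝ :=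
  Real.pi / (m : ℝ) * Real.sin ((2 * (k : ℝ) + 1) / (2 * (m : ℝ)) * Real.pi)

/-- Indices of the tensor grid with `m i` nodes in direction `i`. -/
abbrev GridIdx {d : ℕ} (m : Fin d → ℕ) : Type := (i : Fin d) → Fin (m i)

/-- The number of points of the tensor grid. -/
def gridCard {d : ℕ} (m : Fin d → ℕ) : ℕ := Fintype.card (GridIdx m)

/-- The points of the tensor grid. -/
def gridNode {d : ℕ} (m : Fin d → ℕ) (k : GridIdx m) : Fin d → ℝ :=
  fun i => chebNode (m i) (k i)

/-- The weights of the tensor grid: products of the one-dimensional weights. -/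
def gridWeight {d : ℕ} (m : Fin d → ℕ) (k : GridIdx m) : ℝ :=
  ∏ i, chebWeight (m i) (k i)

/-- The tensor Lagrange basis function of the grid point `k`, evaluated at `x`. -/
def gridLagrange {d : ℕ} (m : Fin d → ℕ) (k : GridIdx m) (x : Fin d → ℝ) : ℝ :=
  ∏ i, (Lagrange.basis Finset.univ (chebNode (m i)) (k i)).eval (x i)

/-- The cube `[-1,1]^d`. -/
def cube (d : ℕ) : Set (Fin d → ℝ) := {x | ∀ i, x i ∈ Set.Icc (-1 : ℝ) 1}

/-- Interpolation of the kernel at the two grids approximates it within `δ`, uniformly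
on `[-1,1]^d × [-1,1]^d`. -/
def InterpolatesWithin {d : ℕ} (K : (Fin d → ℝ) → (Fin d → ℝ) → ℝ)
    (mX mY : Fin d → ℕ) (δ : ℝ) : Prop :=
  ∀ x ∈ cube d, ∀ y ∈ cube d,
    |K x y - ∑ k : GridIdx mX, ∑ l : GridIdx mY,
      gridLagrange mX k x * K (gridNode mX k) (gridNode mY l) * gridLagrange mY l y| ≤ δ

/-- The kernel matrix `K(X, Y)` of two finite sequences of points. -/
def kernelMatrix {d : ℕ} (K : (Fin d → ℝ) → (Fin d → ℝ) → ℝ) {α β : Type*}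
    (X : α → Fin d → ℝ) (Y : β → Fin d → ℝ) : Matrix α β ℝ :=
  Matrix.of fun a b => K (X a) (Y b)

/-- The weighted node matrix `K_w = diag(W_X)^{1/2} K(X̄, Ȳ) diag(W_Y)^{1/2}`. -/
def nodeMatrix {d : ℕ} (K : (Fin d → ℝ) → (Fin d → ℝ) → ℝ) (mX mY : Fin d → ℕ) :
    Matrix (GridIdx mX) (GridIdx mY) ℝ :=
  Matrix.diagonal (fun k => Real.sqrt (gridWeight mX k)) *
    kernelMatrix K (gridNode mX) (gridNode mY) *
    Matrix.diagonal (fun l => Real.sqrt (gridWeight mY l))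

/-! ### Strong rank-revealing QR factorizations -/

/-- The `i`-th singular value of a matrix, in decreasing order and zero-based:
`singVal A 0` is the largest one, and `singVal A i = 0` for `i ≥ rank A`. -/
def singVal {μ ν : Type*} [Fintype μ] [Fintype ν] [DecidableEq ν]
    (A : Matrix μ ν ℝ) (i : ℕ) : ℝ :=
  (Matrix.toEuclideanLin A).singularValues i

/-- The Frobenius norm. -/
def frobNorm {μ ν : Type*} [Fintype μ] [Fintype ν] (A : Matrix μ ν ℝ) : ℝ :=
  Real.sqrt (∑ i, ∑ j, A i j ^ 2)

/-- The value `q(a, b)` of a real polynomial in two variables at natural numbers. -/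
def polyVal (q : MvPolynomial (Fin 2) ℝ) (a b : ℕ) : ℝ :=
  MvPolynomial.eval ![(a : ℝ), (b : ℝ)] q

/-- A column-pivoted QR factorization `A Π = Q R`, with `Q` orthogonal and `R` upper triangular
(trapezoidal), split after the first `k` rows and columns of `R`; the leading block `R₁₁`
is invertible. -/
structure PivotedQR {μ ν : Type*} [Fintype μ] [Fintype ν]
    (A : Matrix μ ν ℝ) (k : ℕ) where
  /-- the column permutation `Π` -/
  perm : Fin (Fintype.card ν) ≃ ν
  /-- the orthogonal factor -/
  Q : Matrix μ (Fin (Fintype.card μ)) ℝ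
  /-- the triangular factor -/
  R : Matrix (Fin (Fintype.card μ)) (Fin (Fintype.card ν)) ℝ
  orthogonal : Qᵀ * Q = 1
  triangular : ∀ (i : Fin (Fintype.card μ)) (j : Fin (Fintype.card ν)), (j : ℕ) < (i : ℕ) → R i j = 0
  factor : A.submatrix id perm = Q * R
  le_rows : k ≤ Fintype.card μ
  le_cols : k ≤ Fintype.card ν
  leading_isUnit : IsUnit (R.submatrix (Fin.castLE le_rows) (Fin.castLE le_cols)).det

namespace PivotedQR

variable {μ ν : Type*} [Fintype μ] [Fintype ν] {A : Matrix μ ν ℝ} {k : ℕ}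

/-- The leading `k × k` block `R₁₁`. -/
def R₁₁ (F : PivotedQR A k) : Matrix (Fin k) (Fin k) ℝ :=
  F.R.submatrix (Fin.castLE F.le_rows) (Fin.castLE F.le_cols)

/-- The position of the `j`-th column after the first `k` ones. -/
def tailIdx (F : PivotedQR A k) (j : Fin (Fintype.card ν - k)) : Fin (Fintype.card ν) :=
  ⟨k + (j : ℕ), by have h₁ := j.isLt; have h₂ := F.le_cols; omega⟩

/-- The upper right block `R₁₂`. -/
def R₁₂ (F : PivotedQR A k) : Matrix (Fin k) (Fin (Fintype.card ν - k)) ℝ :=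
  F.R.submatrix (Fin.castLE F.le_rows) F.tailIdx

/-- The pivots: the `k` columns of `A` that `Π` moves to the front. -/
def pivot (F : PivotedQR A k) (j : Fin k) : ν := F.perm (Fin.castLE F.le_cols j)

/-- The matrix `A₁` of the `k` pivot columns of `A`. -/
def A₁ (F : PivotedQR A k) : Matrix μ (Fin k) ℝ := A.submatrix id F.pivot

/-- The interpolation operator `T = R₁₁⁻¹ R₁₂`. -/
def T (F : PivotedQR A k) : Matrix (Fin k) (Fin (Fintype.card ν - k)) ℝ := F.R₁₁⁻¹ * F.R₁₂

/-- The matrix `[I  T]`. -/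
def IT (F : PivotedQR A k) : Matrix (Fin k) (Fin (Fintype.card ν)) ℝ :=
  Matrix.of fun i j =>
    if h : (j : ℕ) < k then (1 : Matrix (Fin k) (Fin k) ℝ) i ⟨j, h⟩
    else F.T i ⟨(j : ℕ) - k, by have := j.isLt; omega⟩

/-- The approximation error `E` in `A Π = A₁ [I  T] + E`. -/
def E (F : PivotedQR A k) : Matrix μ (Fin (Fintype.card ν)) ℝ :=
  A.submatrix id F.perm - F.A₁ * F.IT

/-- The factorization is a *strong* rank-revealing one, with bounds `q₁(n, k)` and `q₂(n, k)`
where `n` is the number of columns of `A`: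
`σ_i(A₁) ≥ σ_i(A) / q₁`, `σ_j(E) ≤ σ_{k+j}(A) q₁` and `‖T‖_F ≤ q₂`. -/
structure IsStrong [DecidableEq ν] (q₁ q₂ : MvPolynomial (Fin 2) ℝ) (F : PivotedQR A k) :
    Prop where
  lower : ∀ i < k, singVal A i ≤ polyVal q₁ (Fintype.card ν) k * singVal F.A₁ i
  upper : ∀ j, singVal F.E j ≤ singVal A (k + j) * polyVal q₁ (Fintype.card ν) k
  interp : frobNorm F.T ≤ polyVal q₂ (Fintype.card ν) k

end PivotedQR

/-- `k` pivot rows `I` and `k` pivot columns `J` of `A` selected through strong rank-revealing QR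
factorizations (a CUR decomposition), with error `ε` in the spectral norm.

The columns always come from a strong RRQR of `A`. The rows come
* either (`successive`) from a strong RRQR of `A(:, J)ᵀ`, the transpose of the column skeleton;
* or (`simultaneous`) from a strong RRQR of `Aᵀ`, the core `A(I, J)` inheriting the lower bound
  on the singular values. (Two independent factorizations of `A` and `Aᵀ` do not give this by
  themselves: for `A = 1` and `k = 1` the core may be zero.) -/
inductive IsStrongCUR (q₁ q₂ : MvPolynomial (Fin 2) ℝ) {μ ν : Type*} [Fintype μ] [Fintype ν]
    [DecidableEq μ] [DecidableEq ν] (A : Matrix μ ν ℝ) {k : ℕ}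
    (I : Fin k → μ) (J : Fin k → ν) (ε : ℝ) : Prop
  | successive (F : PivotedQR A k) (G : PivotedQR (A.submatrix id J)ᵀ k)
      (hF : F.IsStrong q₁ q₂) (hG : G.IsStrong q₁ q₂)
      (hJ : F.pivot = J) (hI : G.pivot = I)
      (hε : ε = ‖F.E‖) : IsStrongCUR q₁ q₂ A I J ε
  | simultaneous (F : PivotedQR A k) (G : PivotedQR Aᵀ k)
      (hF : F.IsStrong q₁ q₂) (hG : G.IsStrong q₁ q₂)
      (hJ : F.pivot = J) (hI : G.pivot = I)
      (hcore : ∀ i < k, singVal A i ≤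
        polyVal q₁ (max (Fintype.card μ) (Fintype.card ν)) k * singVal (A.submatrix I J) i)
      (hε : ε = max ‖F.E‖ ‖G.E‖) : IsStrongCUR q₁ q₂ A I J ε

/-! ### The skeletonized interpolant -/

/-- `K(x, Ŷ) K(X̂, Ŷ)⁻¹ K(X̂, y)`. -/
def skelApprox {d k : ℕ} (K : (Fin d → ℝ) → (Fin d → ℝ) → ℝ)
    (Xhat Yhat : Fin k → Fin d → ℝ) (x y : Fin d → ℝ) : ℝ :=
  (fun j => K x (Yhat j)) ⬝ᵥ ((kernelMatrix K Xhat Yhat)⁻¹ *ᵥ fun i => K (Xhat i) y)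

end SkelInterp

end

/-! Let A be the node matrix, N = A(I, J) the core, M = N⁻¹, and let s, t be the Lagrange functions
at x, y divided by the roots of the weights. Up to δ ≤ ε, interpolation says K(x, y) = sᵀAt. At a
node the Lagrange functions become a unit vector, so the weighted values of K(x, ·) and K(·, y) at
the pivots are sᵀA(:, J) and A(I, :)t up to 4^d δ. The weights cancel in the cross approximation,
and what has to be bounded is a perturbed cross approximation of sᵀAt.

The danger is M, whose size is about 1/σ_k(A) and is not controlled. Strong RRQR gives ε ≤ q
σ_{k+1}(A) ≤ q σ_k(A), and σ_k(A) is at most a polynomial multiple of σ_k(N); hence ε|M| is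
polynomially bounded. So it suffices that M only occurs next to an error of order ε. The
interpolative factorizations A = A(:, J) P + D and A(:, J) = L N + G give this: M A(I, :) = P + M
D(I, :) and A(:, J) M = L + G M. Expanding the error leaves five terms, each ε times a polynomial
(`CoreBounds.abs_sub_le`).

The vectors s, t are polynomially bounded because each Chebyshev Lagrange polynomial is at most m on
[-1,1] and each weight is at least 1/m². Both selections of the rows lead to the same data,
`CoreBounds`, with one number B dominating every polynomial factor. -/

/-! ### Singular values of a linear map and of its adjoint -/

namespace LinearMap

open Module

variable {E F : Type*} [NormedAddCommGroup E] [InnerProductSpace ℝ E] [FiniteDimensional ℝ E]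
  [NormedAddCommGroup F] [InnerProductSpace ℝ F] [FiniteDimensional ℝ F] (T : E →ₗ[ℝ] F)

/-- A basis of right singular vectors. -/
noncomputable def rightSingularBasis : OrthonormalBasis (Fin (finrank ℝ E)) ℝ E :=
  T.isSymmetric_adjoint_comp_self.eigenvectorBasis rfl

theorem adjoint_apply_rightSingularBasis (i : Fin (finrank ℝ E)) :
    adjoint T (T (T.rightSingularBasis i)) =
      (T.singularValues i ^ 2) • T.rightSingularBasis i := by
  have h := T.isSymmetric_adjoint_comp_self.apply_eigenvectorBasis rfl i
  rw [T.sq_singularValues_fin rfl i]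
  exact h

theorem norm_apply_sq_eq_sum (x : E) :
    ‖T x‖ ^ 2 = ∑ i : Fin (finrank ℝ E),
      T.singularValues i ^ 2 * inner ℝ (T.rightSingularBasis i) x ^ 2 := by
  rw [← real_inner_self_eq_norm_sq, ← adjoint_inner_left,
    ← T.rightSingularBasis.sum_inner_mul_inner]
  refine Finset.sum_congr rfl fun i _ => ?_
  rw [adjoint_inner_left, ← adjoint_inner_right, adjoint_apply_rightSingularBasis,
    real_inner_smul_right, real_inner_comm x]
  ring

theorem norm_sq_eq_sum_rightSingularBasis (x : E) :
    ‖x‖ ^ 2 = ∑ i : Fin (finrank ℝ E), inner ℝ (T.rightSingularBasis i) x ^ 2 := by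
  rw [← T.rightSingularBasis.sum_sq_norm_inner_right]
  simp

/-- The singular value `σ_k` bounds `T` on the orthogonal complement of the first `k` right
singular vectors. -/
theorem norm_apply_le_singularValues_mul (k : ℕ) (x : E)
    (hx : ∀ i : Fin (finrank ℝ E), (i : ℕ) < k → inner ℝ (T.rightSingularBasis i) x = 0) :
    ‖T x‖ ≤ T.singularValues k * ‖x‖ := by
  refine le_of_sq_le_sq ?_ (mul_nonneg (T.singularValues_nonneg k) (norm_nonneg x))
  rw [mul_pow, norm_apply_sq_eq_sum, T.norm_sq_eq_sum_rightSingularBasis, Finset.mul_sum]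
  refine Finset.sum_le_sum fun i _ => ?_
  rcases lt_or_ge (i : ℕ) k with h | h
  · simp [hx i h]
  · gcongr
    · exact T.singularValues_nonneg _
    · exact T.singularValues_antitone h

/-- `T` stretches the span of the first `k + 1` right singular vectors by at least `σ_k`. -/
theorem singularValues_mul_le_norm_apply (k : ℕ) (x : E)
    (hx : ∀ i : Fin (finrank ℝ E), k < (i : ℕ) → inner ℝ (T.rightSingularBasis i) x = 0) :
    T.singularValues k * ‖x‖ ≤ ‖T x‖ := by
  refine le_of_sq_le_sq ?_ (norm_nonneg _)
  rw [mul_pow, norm_apply_sq_eq_sum, T.norm_sq_eq_sum_rightSingularBasis, Finset.mul_sum]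
  refine Finset.sum_le_sum fun i _ => ?_
  rcases lt_or_ge k (i : ℕ) with h | h
  · simp [hx i h]
  · gcongr
    · exact T.singularValues_nonneg _
    · exact T.singularValues_antitone h

/-- Upper half of the Courant–Fischer characterization of singular values. -/
theorem singularValues_le_of_forall_ker {k : ℕ} (L : E →ₗ[ℝ] (Fin k → ℝ)) {c : ℝ} (hc : 0 ≤ c)
    (h : ∀ x, L x = 0 → ‖T x‖ ≤ c * ‖x‖) : T.singularValues k ≤ c := by
  rcases le_or_gt (finrank ℝ E) k with hk | hk
  · rwa [T.singularValues_of_finrank_le hk]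
  let b := T.rightSingularBasis
  let f : (Fin (k + 1) → ℝ) →ₗ[ℝ] E :=
    Fintype.linearCombination ℝ fun i : Fin (k + 1) => b (Fin.castLE hk i)
  have hf : Function.Injective f := by
    have : LinearIndependent ℝ (fun i : Fin (k + 1) => b (Fin.castLE hk i)) :=
      b.orthonormal.linearIndependent.comp _ (Fin.castLE_injective hk)
    exact linearIndependent_iff_injective_fintypeLinearCombination.1 this
  -- Dimension count: k functionals cannot separate k + 1 right singular vectors, and on their span
  -- `T` stretches by at least σ_k.
  obtain ⟨a, ha, ha0⟩ : ∃ a, a ∈ ker (L ∘ₗ f) ∧ a ≠ 0 := by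
    refine (Submodule.ne_bot_iff _).1 ?_
    apply ker_ne_bot_of_finrank_lt
    simp
  have hx0 : f a ≠ 0 := fun h0 => ha0 (hf (by simpa using h0))
  have hpos : 0 < ‖f a‖ := norm_pos_iff.2 hx0
  have h₁ := T.singularValues_mul_le_norm_apply k (f a) fun i hi => by
    simp only [f, Fintype.linearCombination_apply, inner_sum, real_inner_smul_right]
    refine Finset.sum_eq_zero fun j _ => ?_
    have hne : i ≠ Fin.castLE hk j := by
      intro hij
      have := congrArg Fin.val hij
      simp only [Fin.val_castLE] at this
      omega
    rw [b.orthonormal.2 hne, mul_zero]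
  exact le_of_mul_le_mul_right (h₁.trans (h _ ha)) hpos

/-- Test against the k functionals ⟨T bᵢ, ·⟩. If they vanish at y, then z = T*y is orthogonal to the
first k right singular vectors, so ‖z‖² = ⟨Tz, y⟩ ≤ σ_k ‖z‖ ‖y‖. The equality that follows is needed
because rows are selected by factoring transposes. -/
theorem singularValues_adjoint_le (k : ℕ) :
    (adjoint T).singularValues k ≤ T.singularValues k := by
  rcases le_or_gt (finrank ℝ E) k with hk | hk
  · refine (singularValues_eq_zero_iff_le_finrank_range _).2 ?_ |>.trans_le
      (T.singularValues_nonneg k)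
    exact (Submodule.finrank_le _).trans hk
  let b := T.rightSingularBasis
  refine singularValues_le_of_forall_ker _
    (LinearMap.pi fun i : Fin k => innerₛₗ ℝ (T (b (Fin.castLE hk.le i))))
    (T.singularValues_nonneg k) fun y hy => ?_
  set z := adjoint T y with hz
  have h₁ : ‖T z‖ ≤ T.singularValues k * ‖z‖ := by
    refine T.norm_apply_le_singularValues_mul k z fun i hi => ?_
    have := congrFun hy ⟨i, hi⟩
    rw [hz, adjoint_inner_right]
    simpa using this
  have h₂ : ‖z‖ * ‖z‖ ≤ T.singularValues k * ‖y‖ * ‖z‖ := by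
    calc ‖z‖ * ‖z‖ = inner ℝ (T z) y := by
          rw [← real_inner_self_eq_norm_mul_norm]
          nth_rewrite 2 [hz]
          rw [adjoint_inner_right]
      _ ≤ ‖T z‖ * ‖y‖ := real_inner_le_norm _ _
      _ ≤ T.singularValues k * ‖z‖ * ‖y‖ := by gcongr
      _ = _ := by ring
  rcases (norm_nonneg z).eq_or_lt with h0 | h0
  · rw [← h0]
    exact mul_nonneg (T.singularValues_nonneg k) (norm_nonneg y)
  · exact le_of_mul_le_mul_right h₂ h0

theorem singularValues_adjoint (k : ℕ) :
    (adjoint T).singularValues k = T.singularValues k := by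
  refine le_antisymm (singularValues_adjoint_le T k) ?_
  simpa using singularValues_adjoint_le (adjoint T) k

end LinearMap

namespace SkelInterp

/-! ### Singular values of matrices -/

section SingVal

variable {μ ν : Type*} [Fintype μ] [Fintype ν] [DecidableEq ν]

theorem singVal_nonneg (A : Matrix μ ν ℝ) (i : ℕ) : 0 ≤ singVal A i :=
  LinearMap.singularValues_nonneg _ i

theorem singVal_antitone (A : Matrix μ ν ℝ) : Antitone (singVal A) :=
  LinearMap.singularValues_antitone _

theorem singVal_transpose [DecidableEq μ] (A : Matrix μ ν ℝ) (i : ℕ) :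
    singVal Aᵀ i = singVal A i := by
  unfold singVal
  rw [← Matrix.conjTranspose_eq_transpose_of_trivial, Matrix.toEuclideanLin_conjTranspose_eq_adjoint,
    LinearMap.singularValues_adjoint]

theorem norm_le_singVal_zero (A : Matrix μ ν ℝ) : ‖A‖ ≤ singVal A 0 := by
  rw [Matrix.l2_opNorm_def]
  refine ContinuousLinearMap.opNorm_le_bound _ (singVal_nonneg A 0) fun x => ?_
  exact LinearMap.norm_apply_le_singularValues_mul _ 0 x fun i hi => absurd hi (Nat.not_lt_zero _)

theorem abs_apply_le_norm (A : Matrix μ ν ℝ) (i : μ) (j : ν) : |A i j| ≤ ‖A‖ := by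
  have h := Matrix.l2_opNorm_mulVec A (EuclideanSpace.single j 1)
  rw [PiLp.norm_single, norm_one, mul_one] at h
  refine le_trans ?_ h
  refine le_trans (le_of_eq ?_) (PiLp.norm_apply_le _ i)
  simp

/-- A matrix with `k` columns stretches every vector by at least its `k`-th singular value. -/
theorem singVal_mul_norm_le (A : Matrix μ ν ℝ) {k : ℕ} (hk : Fintype.card ν ≤ k + 1)
    (x : EuclideanSpace ℝ ν) :
    singVal A k * ‖x‖ ≤ ‖Matrix.toEuclideanLin A x‖ := by
  refine LinearMap.singularValues_mul_le_norm_apply _ k x fun i hi => ?_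
  have := i.isLt
  simp only [finrank_euclideanSpace] at this
  omega

theorem isUnit_det_of_singVal_pos {k : ℕ} (A : Matrix (Fin k) (Fin k) ℝ)
    (h : ∀ i < k, 0 < singVal A i) : IsUnit A.det := by
  have hinj : Function.Injective (Matrix.toEuclideanLin A) := by
    rw [LinearMap.injective_iff_forall_lt_finrank_singularValues_pos]
    exact fun i hi => h i (by simpa using hi)
  rw [← Matrix.isUnit_iff_isUnit_det, ← Matrix.mulVec_injective_iff_isUnit]
  intro x y hxy
  have : Matrix.toEuclideanLin A (WithLp.toLp 2 x) = Matrix.toEuclideanLin A (WithLp.toLp 2 y) := by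
    simp only [Matrix.toLpLin_toLp, Matrix.toLin'_apply]
    congr 1
  simpa using hinj this

/-- Column j of the inverse is mapped to a unit vector, and index k - 1 is the smallest singular
value (zero-based; k > 0 since i exists). -/
theorem singVal_mul_abs_inv_apply_le {k : ℕ} (A : Matrix (Fin k) (Fin k) ℝ)
    (hA : IsUnit A.det) (i j : Fin k) : singVal A (k - 1) * |A⁻¹ i j| ≤ 1 := by
  let x : EuclideanSpace ℝ (Fin k) := WithLp.toLp 2 (A⁻¹ *ᵥ Pi.single j 1)
  have h := singVal_mul_norm_le A (k := k - 1) (by simp; omega) x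
  have hx : Matrix.toEuclideanLin A x = EuclideanSpace.single j 1 := by
    simp only [x, Matrix.toLpLin_toLp, Matrix.toLin'_apply, Matrix.mulVec_mulVec, Matrix.mul_nonsing_inv A hA,
      Matrix.one_mulVec]
    rfl
  rw [hx, PiLp.norm_single, norm_one] at h
  refine le_trans (mul_le_mul_of_nonneg_left ?_ (singVal_nonneg _ _)) h
  have := PiLp.norm_apply_le x i
  simpa [x] using this

/-- A matrix with `k` linearly independent columns has `k` positive singular values. -/
theorem singVal_pos_of_injective_submatrix (A : Matrix μ ν ℝ) {k : ℕ} (J : Fin k → ν)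
    (h : Function.Injective (A.submatrix id J).mulVec) {i : ℕ} (hi : i < k) :
    0 < singVal A i := by
  unfold singVal
  rw [LinearMap.singularValues_pos_iff_lt_finrank_range]
  refine hi.trans_le ?_
  have hli : LinearIndependent ℝ (A.submatrix id J).col := Matrix.mulVec_injective_iff.1 h
  have hli' : LinearIndependent ℝ
      fun j : Fin k => (⟨Matrix.toEuclideanLin A (EuclideanSpace.single (J j) 1),
        LinearMap.mem_range_self _ _⟩ : LinearMap.range (Matrix.toEuclideanLin A)) := by
    refine LinearIndependent.of_comp
      ((WithLp.linearEquiv 2 ℝ (μ → ℝ)).toLinearMap ∘ₗ Submodule.subtype _) ?_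
    have heq : ((WithLp.linearEquiv 2 ℝ (μ → ℝ)).toLinearMap ∘ₗ Submodule.subtype _) ∘
        (fun j : Fin k => (⟨Matrix.toEuclideanLin A (EuclideanSpace.single (J j) 1),
          LinearMap.mem_range_self _ _⟩ : LinearMap.range (Matrix.toEuclideanLin A))) =
        (A.submatrix id J).col := by
      ext j a
      simp [Matrix.col]
    rw [heq]
    exact hli
  simpa using hli'.fintype_card_le_finrank

end SingVal

/-! ### Chebyshev nodes: Lagrange polynomials and weights -/

section Chebyshev

open Polynomial

theorem chebNode_angle_mem {m : ℕ} (k : Fin m) :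
    (2 * (k : ℝ) + 1) / (2 * (m : ℝ)) * Real.pi ∈ Set.Ioo 0 Real.pi := by
  have hm : (0 : ℝ) < m := by exact_mod_cast k.pos
  have hk : (k : ℝ) + 1 ≤ m := by exact_mod_cast k.isLt
  constructor
  · have := Real.pi_pos
    positivity
  · refine mul_lt_of_lt_one_left Real.pi_pos ?_
    rw [div_lt_one (by positivity)]
    linarith

theorem chebNode_mem_Icc {m : ℕ} (k : Fin m) : chebNode m k ∈ Set.Icc (-1 : ℝ) 1 :=
  ⟨Real.neg_one_le_cos _, Real.cos_le_one _⟩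

theorem chebNode_injective (m : ℕ) : Function.Injective (chebNode m) := by
  intro k l h
  have hm : (0 : ℝ) < m := by exact_mod_cast k.pos
  have := Real.injOn_cos (Set.Ioo_subset_Icc_self (chebNode_angle_mem k))
    (Set.Ioo_subset_Icc_self (chebNode_angle_mem l)) h
  have h₁ := mul_right_cancel₀ Real.pi_ne_zero this
  rw [div_left_inj' (by positivity)] at h₁
  have h₂ : (k : ℝ) = l := by linarith
  exact Fin.ext (by exact_mod_cast h₂)

theorem cos_chebNode_angle {m : ℕ} (k : Fin m) :
    Real.cos (m * ((2 * (k : ℝ) + 1) / (2 * (m : ℝ)) * Real.pi)) = 0 := by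
  have hm : (m : ℝ) ≠ 0 := by exact_mod_cast k.pos.ne'
  rw [Real.cos_eq_zero_iff]
  refine ⟨k, ?_⟩
  push_cast
  field_simp

theorem eval_T_chebNode {m : ℕ} (k : Fin m) : (Chebyshev.T ℝ m).eval (chebNode m k) = 0 := by
  rw [chebNode, Chebyshev.T_real_cos]
  exact_mod_cast cos_chebNode_angle k

/-- T_m' = m U_{m-1} and U_{m-1}(cos θ) sin θ = sin mθ, which is ±1 at a zero of cos mθ. -/
theorem le_abs_eval_derivative_T_chebNode {m : ℕ} (k : Fin m) :
    (m : ℝ) ≤ |(derivative (Chebyshev.T ℝ m)).eval (chebNode m k)| := by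
  set θ := (2 * (k : ℝ) + 1) / (2 * (m : ℝ)) * Real.pi with hθ
  have hU := Chebyshev.U_real_cos θ ((m : ℤ) - 1)
  have hs : |Real.sin (m * θ)| = 1 := by
    have h₁ := Real.sin_sq_add_cos_sq (m * θ)
    rw [cos_chebNode_angle k] at h₁
    rw [← sq_eq_sq₀ (abs_nonneg _) zero_le_one, sq_abs]
    linarith
  have hU' : 1 ≤ |(Chebyshev.U ℝ ((m : ℤ) - 1)).eval (Real.cos θ)| := by
    have h₂ := congrArg abs hU
    have h₃ : (((m : ℤ) - 1 : ℤ) : ℝ) + 1 = m := by push_cast; ring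
    rw [h₃, hs, abs_mul] at h₂
    rw [← h₂]
    exact mul_le_of_le_one_right (abs_nonneg _) (Real.abs_sin_le_one θ)
  rw [Chebyshev.T_derivative_eq_U]
  simp only [Int.cast_natCast, eval_mul, eval_natCast, abs_mul, Nat.abs_cast]
  exact le_mul_of_one_le_right (Nat.cast_nonneg m) hU'

theorem abs_eval_derivative_T_le (m : ℕ) {x : ℝ} (hx : x ∈ Set.Icc (-1 : ℝ) 1) :
    |(derivative (Chebyshev.T ℝ m)).eval x| ≤ (m : ℝ) ^ 2 := by
  have h := Chebyshev.abs_iterate_derivative_T_real_le m 1 (abs_le.2 hx)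
  simpa [Chebyshev.derivative_T_eval_one] using h

/-- The Lagrange basis polynomials of the `m` Chebyshev nodes are bounded by `m` on `[-1,1]`. -/
theorem abs_eval_lagrangeBasis_chebNode_le {m : ℕ} (k : Fin m) {x : ℝ}
    (hx : x ∈ Set.Icc (-1 : ℝ) 1) :
    |(Lagrange.basis Finset.univ (chebNode m) k).eval x| ≤ m := by
  have hm : (0 : ℝ) < m := by exact_mod_cast k.pos
  set p := Chebyshev.T ℝ m with hp
  set a := chebNode m k with ha
  -- The basis polynomial is g / g(a) with g = T_m / (X - a). Here |g(a)| = |T_m'(a)| ≥ m, while the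
  -- mean value inequality and |T_m'| ≤ m² give |g| ≤ m² on [-1,1].
  obtain ⟨g, hg⟩ : X - C a ∣ p := dvd_iff_isRoot.2 (eval_T_chebNode k)
  have hda : (derivative p).eval a = g.eval a := by
    rw [hg]; simp
  have hp0 : p ≠ 0 := by
    intro h0
    have := le_abs_eval_derivative_T_chebNode k
    rw [← hp, h0] at this
    simp only [derivative_zero, eval_zero, abs_zero] at this
    linarith
  have hg0 : g ≠ 0 := by
    rintro rfl
    exact hp0 (by simpa using hg)
  have hdeg : g.degree < (Finset.univ : Finset (Fin m)).card := by
    have h₁ : p.natDegree = 1 + g.natDegree := by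
      rw [hg, natDegree_mul (X_sub_C_ne_zero a) hg0, natDegree_X_sub_C]
    have h₂ : p.natDegree = m := by
      rw [hp, Chebyshev.natDegree_T]; simp
    rw [Finset.card_univ, Fintype.card_fin, degree_eq_natDegree hg0]
    exact_mod_cast (by omega : g.natDegree < m)
  have hbasis : g = C (g.eval a) * Lagrange.basis Finset.univ (chebNode m) k := by
    refine eq_of_degrees_lt_of_eval_index_eq (v := chebNode m) Finset.univ
      (chebNode_injective m).injOn hdeg ?_ fun j _ => ?_
    · refine (degree_mul_le _ _).trans_lt ((add_le_add_left degree_C_le _).trans_lt ?_)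
      rw [zero_add, Lagrange.degree_basis (chebNode_injective m).injOn (Finset.mem_univ k)]
      have := k.pos
      rw [Finset.card_univ, Fintype.card_fin]
      exact_mod_cast (by omega : m - 1 < m)
    · rcases eq_or_ne k j with rfl | hkj
      · rw [eval_mul, Lagrange.eval_basis_self (chebNode_injective m).injOn (Finset.mem_univ k)]
        simp [ha]
      · rw [eval_mul, Lagrange.eval_basis_of_ne hkj (Finset.mem_univ j), mul_zero]
        have h₁ := eval_T_chebNode j
        rw [← hp, hg, eval_mul, eval_sub, eval_X, eval_C] at h₁
        refine (mul_eq_zero.1 h₁).resolve_left ?_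
        exact sub_ne_zero.2 fun h => hkj (chebNode_injective m h.symm)
  have hgx : |g.eval x| ≤ (m : ℝ) ^ 2 := by
    rcases eq_or_ne x a with rfl | hxa
    · rw [← hda]
      exact abs_eval_derivative_T_le m hx
    · have h₁ : ‖p.eval x - p.eval a‖ ≤ (m : ℝ) ^ 2 * ‖x - a‖ :=
        (convex_Icc (-1 : ℝ) 1).norm_image_sub_le_of_norm_hasDerivWithin_le
          (f := fun y => p.eval y) (f' := fun y => (derivative p).eval y)
          (fun y _ => (p.hasDerivAt y).hasDerivWithinAt)
          (fun y hy => abs_eval_derivative_T_le m hy) (chebNode_mem_Icc k) hx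
      have h₂ : p.eval x - p.eval a = (x - a) * g.eval x := by
        rw [hg]; simp
      rw [h₂, norm_mul, mul_comm] at h₁
      exact le_of_mul_le_mul_right h₁ (norm_pos_iff.2 (sub_ne_zero.2 hxa))
  have hga : (m : ℝ) ≤ |g.eval a| := by
    rw [← hda]
    exact le_abs_eval_derivative_T_chebNode k
  have h₁ : |g.eval x| = |g.eval a| * |(Lagrange.basis Finset.univ (chebNode m) k).eval x| := by
    conv_lhs => rw [hbasis]
    rw [eval_mul, eval_C, abs_mul]
  rw [h₁] at hgx
  have h₂ : (m : ℝ) * |(Lagrange.basis Finset.univ (chebNode m) k).eval x| ≤ m * m := by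
    calc _ ≤ |g.eval a| * |(Lagrange.basis Finset.univ (chebNode m) k).eval x| := by gcongr
      _ ≤ _ := hgx
      _ = _ := by ring
  exact le_of_mul_le_mul_left h₂ hm

/-- Jordan's inequality sin θ ≥ 2θ/π, applied to θ or π - θ, bounds the sine below by 1/m; the other
factor is π/m ≥ 1/m. -/
theorem inv_sq_le_chebWeight {m : ℕ} (k : Fin m) : ((m : ℝ) ^ 2)⁻¹ ≤ chebWeight m k := by
  have hm : (0 : ℝ) < m := by exact_mod_cast k.pos
  have hk : (k : ℝ) + 1 ≤ m := by exact_mod_cast k.isLt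
  have hpi := Real.pi_pos
  set c := (2 * (k : ℝ) + 1) / (2 * (m : ℝ)) with hc
  have hsin : 1 / (m : ℝ) ≤ Real.sin (c * Real.pi) := by
    rcases le_total (2 * (k : ℝ) + 1) m with h | h
    · have h₁ : c ≤ 1 / 2 := by
        rw [hc, div_le_div_iff₀ (by positivity) (by norm_num)]; linarith
      have := Real.mul_le_sin (x := c * Real.pi) (by positivity) (by nlinarith)
      refine le_trans ?_ this
      have h₂ : 2 / Real.pi * (c * Real.pi) = (2 * (k : ℝ) + 1) / m := by
        rw [hc]; field_simp
      rw [h₂]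
      gcongr
      linarith [(Nat.cast_nonneg (k : ℕ) : (0 : ℝ) ≤ (k : ℕ))]
    · have h₁ : 1 / 2 ≤ c := by
        rw [hc, div_le_div_iff₀ (by norm_num) (by positivity)]; linarith
      have h₃ : c ≤ 1 := by
        rw [hc, div_le_one (by positivity)]; linarith
      rw [← Real.sin_pi_sub]
      have := Real.mul_le_sin (x := Real.pi - c * Real.pi) (by nlinarith) (by nlinarith)
      refine le_trans ?_ this
      have h₂ : 2 / Real.pi * (Real.pi - c * Real.pi) = (2 * m - (2 * (k : ℝ) + 1)) / m := by
        rw [hc]; field_simp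
      rw [h₂]
      gcongr
      linarith
  unfold chebWeight
  calc ((m : ℝ) ^ 2)⁻¹ = 1 / m * (1 / m) := by field_simp
    _ ≤ Real.pi / m * Real.sin (c * Real.pi) := by
      gcongr
      linarith [Real.pi_gt_three]

theorem chebWeight_le {m : ℕ} (k : Fin m) : chebWeight m k ≤ 4 := by
  have hm : (1 : ℝ) ≤ m := by exact_mod_cast k.pos
  unfold chebWeight
  calc _ ≤ Real.pi / m * 1 := by
        gcongr
        exact Real.sin_le_one _
    _ ≤ Real.pi := by
        rw [mul_one]
        exact div_le_self Real.pi_pos.le hm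
    _ ≤ 4 := Real.pi_le_four

end Chebyshev

/-! ### Tensor grids -/

section Grid

variable {d : ℕ} (m : Fin d → ℕ)

theorem gridCard_eq_prod : (gridCard m : ℝ) = ∏ i, (m i : ℝ) := by
  simp [gridCard, GridIdx]

variable {m}

theorem gridNode_mem_cube (k : GridIdx m) : gridNode m k ∈ cube d :=
  fun i => chebNode_mem_Icc (k i)

theorem abs_gridLagrange_le (k : GridIdx m) {x : Fin d → ℝ} (hx : x ∈ cube d) :
    |gridLagrange m k x| ≤ gridCard m := by
  rw [gridLagrange, Finset.abs_prod, gridCard_eq_prod]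
  exact Finset.prod_le_prod (fun _ _ => abs_nonneg _)
    fun i _ => abs_eval_lagrangeBasis_chebNode_le (k i) (hx i)

theorem gridLagrange_gridNode (k l : GridIdx m) :
    gridLagrange m k (gridNode m l) = if k = l then 1 else 0 := by
  unfold gridLagrange gridNode
  split_ifs with h
  · subst h
    exact Finset.prod_eq_one fun i _ =>
      Lagrange.eval_basis_self (chebNode_injective _).injOn (Finset.mem_univ _)
  · obtain ⟨i, hi⟩ := Function.ne_iff.1 h
    exact Finset.prod_eq_zero (Finset.mem_univ i)
      (Lagrange.eval_basis_of_ne hi (Finset.mem_univ _))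

theorem gridCard_pos (k : GridIdx m) : (0 : ℝ) < gridCard m := by
  rw [gridCard_eq_prod]
  exact Finset.prod_pos fun i _ => by exact_mod_cast (k i).pos

theorem inv_sq_le_gridWeight (k : GridIdx m) : ((gridCard m : ℝ) ^ 2)⁻¹ ≤ gridWeight m k := by
  rw [gridCard_eq_prod, ← Finset.prod_pow, ← Finset.prod_inv_distrib]
  exact Finset.prod_le_prod (fun i _ => by positivity) fun i _ => inv_sq_le_chebWeight (k i)

theorem gridWeight_pos (k : GridIdx m) : 0 < gridWeight m k := by
  have := gridCard_pos k
  exact lt_of_lt_of_le (by positivity) (inv_sq_le_gridWeight k)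

theorem sqrt_gridWeight_pos (k : GridIdx m) : 0 < Real.sqrt (gridWeight m k) :=
  Real.sqrt_pos.2 (gridWeight_pos k)

theorem inv_sqrt_gridWeight_le (k : GridIdx m) :
    (Real.sqrt (gridWeight m k))⁻¹ ≤ gridCard m := by
  have h := gridCard_pos k
  rw [inv_le_comm₀ (sqrt_gridWeight_pos k) h]
  apply Real.le_sqrt_of_sq_le
  rw [inv_pow]
  exact inv_sq_le_gridWeight k

theorem sqrt_gridWeight_le (k : GridIdx m) : Real.sqrt (gridWeight m k) ≤ 4 ^ d := by
  have h₁ : gridWeight m k ≤ 4 ^ d := by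
    calc gridWeight m k ≤ ∏ _i : Fin d, (4 : ℝ) :=
          Finset.prod_le_prod (fun i _ => le_trans (by positivity) (inv_sq_le_chebWeight (k i)))
            fun i _ => chebWeight_le (k i)
      _ = 4 ^ d := by simp
  have h₂ : (1 : ℝ) ≤ 4 ^ d := one_le_pow₀ (by norm_num)
  rw [Real.sqrt_le_left (by positivity)]
  nlinarith

end Grid

/-! ### Consequences of a strong RRQR -/

namespace PivotedQR

section

variable {μ ν : Type*} [Fintype μ] [Fintype ν] {A : Matrix μ ν ℝ} {k : ℕ}

theorem transpose_Q_mul_A₁ (F : PivotedQR A k) :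
    F.Qᵀ * F.A₁ = F.R.submatrix id (Fin.castLE F.le_cols) := by
  have h : F.A₁ = F.Q * F.R.submatrix id (Fin.castLE F.le_cols) := by
    change (A.submatrix id F.perm).submatrix id (Fin.castLE F.le_cols) = _
    rw [F.factor]
    rfl
  rw [h, ← Matrix.mul_assoc, F.orthogonal, Matrix.one_mul]

/-- The first k rows of QᵀA₁ form the invertible block R₁₁. -/
theorem injective_mulVec_A₁ (F : PivotedQR A k) : Function.Injective F.A₁.mulVec := by
  intro v w h
  have h₁ : (F.Qᵀ * F.A₁) *ᵥ v = (F.Qᵀ * F.A₁) *ᵥ w := by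
    rw [← Matrix.mulVec_mulVec, ← Matrix.mulVec_mulVec]
    exact congrArg _ h
  rw [transpose_Q_mul_A₁] at h₁
  have hu : IsUnit F.R₁₁ := (Matrix.isUnit_iff_isUnit_det _).2 F.leading_isUnit
  refine Matrix.mulVec_injective_of_isUnit hu ?_
  ext i
  exact congrFun h₁ (Fin.castLE F.le_rows i)

theorem eq_A₁_mul_add (F : PivotedQR A k) :
    A = F.A₁ * F.IT.submatrix id F.perm.symm + F.E.submatrix id F.perm.symm := by
  have h : A.submatrix id F.perm = F.A₁ * F.IT + F.E := by
    rw [E]; abel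
  have h₁ := congrArg (fun M => M.submatrix id F.perm.symm) h
  simp only [Matrix.submatrix_submatrix, Equiv.self_comp_symm, Function.comp_id,
    Matrix.submatrix_id_id] at h₁
  exact h₁

theorem abs_IT_le (F : PivotedQR A k) (i : Fin k) (j : Fin (Fintype.card ν)) :
    |F.IT i j| ≤ 1 + frobNorm F.T := by
  have h0 : 0 ≤ frobNorm F.T := Real.sqrt_nonneg _
  simp only [IT, Matrix.of_apply]
  split_ifs with h
  · rw [Matrix.one_apply]
    split_ifs <;> simp <;> linarith
  · refine le_trans ?_ (le_add_of_nonneg_left zero_le_one)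
    rw [frobNorm]
    apply Real.le_sqrt_of_sq_le
    rw [sq_abs]
    refine le_trans ?_ (Finset.single_le_sum (f := fun i => ∑ j, F.T i j ^ 2)
      (fun _ _ => Finset.sum_nonneg fun _ _ => sq_nonneg _) (Finset.mem_univ i))
    exact Finset.single_le_sum (f := fun j => F.T i j ^ 2) (fun _ _ => sq_nonneg _)
      (Finset.mem_univ _)

variable [DecidableEq ν] {q₁ q₂ : MvPolynomial (Fin 2) ℝ}

/-- This is `upper` at j = 0; with zero-based indices `singVal A k` is σ_{k+1}(A). -/
theorem IsStrong.norm_E_le {F : PivotedQR A k} (hF : F.IsStrong q₁ q₂) {B : ℝ}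
    (hB : polyVal q₁ (Fintype.card ν) k ≤ B) : ‖F.E‖ ≤ B * singVal A k := by
  refine (norm_le_singVal_zero _).trans ((hF.upper 0).trans ?_)
  rw [mul_comm]
  exact mul_le_mul_of_nonneg_right hB (singVal_nonneg _ _)

/-- A strong factorization expresses all columns through the pivot columns, with bounded
coefficients. -/
theorem IsStrong.exists_interp {F : PivotedQR A k} (hF : F.IsStrong q₁ q₂) {B : ℝ}
    (hB : 2 ≤ B) (hq₂ : polyVal q₂ (Fintype.card ν) k ≤ B) :
    ∃ (P : Matrix (Fin k) ν ℝ) (D : Matrix μ ν ℝ), A = F.A₁ * P + D ∧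
      (∀ i j, |P i j| ≤ B ^ 2) ∧ ∀ i j, |D i j| ≤ ‖F.E‖ := by
  refine ⟨_, _, F.eq_A₁_mul_add, fun i j => ?_, fun i j => abs_apply_le_norm F.E i _⟩
  have h₁ := F.abs_IT_le i (F.perm.symm j)
  have h₂ := hF.interp
  -- 1 + B ≤ B² because B ≥ 2.
  exact h₁.trans (by nlinarith)

end

end PivotedQR

/-! ### From either pivot selection to a well-conditioned core -/

section CUR

variable {μ ν : Type*} [Fintype μ] [Fintype ν] [DecidableEq ν]
  {q₁ q₂ : MvPolynomial (Fin 2) ℝ} {A : Matrix μ ν ℝ} {k : ℕ} {I : Fin k → μ} {J : Fin k → ν}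
  {ε : ℝ}

theorem IsStrongCUR.le_card [DecidableEq μ] (h : IsStrongCUR q₁ q₂ A I J ε) : k ≤ Fintype.card ν := by
  cases h with
  | successive F => exact F.le_cols
  | simultaneous F => exact F.le_cols

/-- A core that is well conditioned relative to the error `ε`, together with interpolative
factorizations of the matrix through its columns `J`, and of these columns through the core. -/
structure CoreBounds (A : Matrix μ ν ℝ) (I : Fin k → μ) (J : Fin k → ν) (ε B : ℝ) : Prop where
  isUnit_core : IsUnit (A.submatrix I J).det
  nonneg : 0 ≤ ε
  le_singVal : ε ≤ B * singVal A k
  inv_le : ∀ i j, ε * |(A.submatrix I J)⁻¹ i j| ≤ B ^ 3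
  cols : ∃ (P : Matrix (Fin k) ν ℝ) (D : Matrix μ ν ℝ), A = A.submatrix id J * P + D ∧
    (∀ i j, |P i j| ≤ B ^ 2) ∧ ∀ i j, |D i j| ≤ ε
  rows : ∃ (L : Matrix μ (Fin k) ℝ) (D : Matrix μ (Fin k) ℝ),
    A.submatrix id J = L * A.submatrix I J + D ∧
    (∀ i j, |L i j| ≤ B ^ 2) ∧ ∀ i j, |D i j| ≤ ε

/-- In one-based notation ε ≤ B σ_{k+1}(A) ≤ B σ_k(A) ≤ B³ σ_k(N) for the core N, and σ_k(N) |N⁻¹ i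
j| ≤ 1. The gap between σ_k and σ_{k+1} plays no role. -/
theorem mul_abs_inv_core_le {B : ℝ} (hB : 0 ≤ B) (hu : IsUnit (A.submatrix I J).det)
    (hε : ε ≤ B * singVal A k)
    (hcore : singVal A (k - 1) ≤ B ^ 2 * singVal (A.submatrix I J) (k - 1)) (i j : Fin k) :
    ε * |(A.submatrix I J)⁻¹ i j| ≤ B ^ 3 := by
  have h₁ : singVal A k ≤ singVal A (k - 1) := singVal_antitone A (Nat.sub_le k 1)
  have h₂ := singVal_mul_abs_inv_apply_le _ hu i j
  calc ε * |(A.submatrix I J)⁻¹ i j|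
      ≤ (B * (B ^ 2 * singVal (A.submatrix I J) (k - 1))) * |(A.submatrix I J)⁻¹ i j| := by
        gcongr
        exact hε.trans (mul_le_mul_of_nonneg_left (h₁.trans hcore) hB)
    _ = B ^ 3 * (singVal (A.submatrix I J) (k - 1) * |(A.submatrix I J)⁻¹ i j|) := by ring
    _ ≤ B ^ 3 := mul_le_of_le_one_right (by positivity) h₂

theorem IsStrongCUR.coreBounds [DecidableEq μ] (h : IsStrongCUR q₁ q₂ A I J ε) {B : ℝ} (hB : 2 ≤ B)
    (hq₁ : ∀ n ≤ max (Fintype.card μ) (Fintype.card ν), polyVal q₁ n k ≤ B)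
    (hq₂ : ∀ n ≤ max (Fintype.card μ) (Fintype.card ν), polyVal q₂ n k ≤ B) :
    CoreBounds A I J ε B := by
  have hB0 : 0 ≤ B := by linarith
  have hμ := le_max_left (Fintype.card μ) (Fintype.card ν)
  have hν := le_max_right (Fintype.card μ) (Fintype.card ν)
  cases h with
  | successive F G hF hG hJ hI hε =>
    subst hJ hI hε
    have hu : IsUnit (A.submatrix G.pivot F.pivot).det := by
      have h₁ := G.injective_mulVec_A₁
      have h₂ : G.A₁ = (A.submatrix G.pivot F.pivot)ᵀ := rfl
      rw [h₂, Matrix.mulVec_injective_iff_isUnit, Matrix.isUnit_iff_isUnit_det,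
        Matrix.det_transpose] at h₁
      exact h₁
    have hE := hF.norm_E_le (hq₁ _ hν)
    refine ⟨hu, norm_nonneg _, hE, fun i j => ?_, hF.exists_interp hB (hq₂ _ hν), ?_⟩
    · refine mul_abs_inv_core_le hB0 hu hE ?_ i j
      have hk : k - 1 < k := Nat.sub_lt i.pos one_pos
      have h₁ := hF.lower (k - 1) hk
      have h₂ := hG.lower (k - 1) hk
      have h₃ : G.A₁ = (A.submatrix G.pivot F.pivot)ᵀ := rfl
      have h₄ : F.A₁ = A.submatrix id F.pivot := rfl
      rw [h₃, singVal_transpose, singVal_transpose] at h₂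
      rw [h₄] at h₁
      calc _ ≤ _ := h₁
        _ ≤ B * singVal (A.submatrix id F.pivot) (k - 1) :=
          mul_le_mul_of_nonneg_right (hq₁ _ hν) (singVal_nonneg _ _)
        _ ≤ B * (B * singVal (A.submatrix G.pivot F.pivot) (k - 1)) := by
          gcongr
          exact h₂.trans (mul_le_mul_of_nonneg_right (hq₁ _ hμ) (singVal_nonneg _ _))
        _ = _ := by ring
    · obtain ⟨P, D, h₁, hP, hD⟩ := hG.exists_interp hB (hq₂ _ hμ)
      refine ⟨Pᵀ, Dᵀ, ?_, fun i j => hP j i, fun i j => (hD j i).trans ?_⟩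
      · have h₂ := congrArg Matrix.transpose h₁
        rwa [Matrix.transpose_add, Matrix.transpose_mul, Matrix.transpose_transpose] at h₂
      · have h₂ := hG.norm_E_le (hq₁ _ hμ)
        -- The column skeleton has only k columns, so the second factorization is exact and adds no
        -- error.
        have h₃ : singVal (A.submatrix id F.pivot) k = 0 :=
          LinearMap.singularValues_of_finrank_le _ (by simp)
        rw [singVal_transpose, h₃, mul_zero] at h₂
        exact h₂.trans (norm_nonneg _)
  | simultaneous F G hF hG hJ hI hcore hε =>
    subst hJ hI hε
    have hcore' : ∀ i < k, singVal A i ≤ B * singVal (A.submatrix G.pivot F.pivot) i :=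
      fun i hi => (hcore i hi).trans
        (mul_le_mul_of_nonneg_right (hq₁ _ le_rfl) (singVal_nonneg _ _))
    have hu : IsUnit (A.submatrix G.pivot F.pivot).det := by
      -- The k independent pivot columns make the first k singular values of A positive; the
      -- inherited lower bound passes this on to the core.
      refine isUnit_det_of_singVal_pos _ fun i hi => ?_
      have h₁ := singVal_pos_of_injective_submatrix A F.pivot F.injective_mulVec_A₁ hi
      exact pos_of_mul_pos_right (h₁.trans_le (hcore' i hi)) hB0
    have hE : max ‖F.E‖ ‖G.E‖ ≤ B * singVal A k := by
      refine max_le (hF.norm_E_le (hq₁ _ hν)) ?_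
      have := hG.norm_E_le (hq₁ _ hμ)
      rwa [singVal_transpose] at this
    refine ⟨hu, (norm_nonneg _).trans (le_max_left _ _), hE, fun i j => ?_, ?_, ?_⟩
    · refine mul_abs_inv_core_le hB0 hu hE ?_ i j
      have hk : k - 1 < k := Nat.sub_lt i.pos one_pos
      refine (hcore' _ hk).trans (mul_le_mul_of_nonneg_right ?_ (singVal_nonneg _ _))
      nlinarith
    · obtain ⟨P, D, h₁, hP, hD⟩ := hF.exists_interp hB (hq₂ _ hν)
      exact ⟨P, D, h₁, hP, fun i j => (hD i j).trans (le_max_left _ _)⟩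
    · obtain ⟨P, D, h₁, hP, hD⟩ := hG.exists_interp hB (hq₂ _ hμ)
      refine ⟨Pᵀ, (D.submatrix F.pivot id)ᵀ, ?_, fun i j => hP j i,
        fun i j => (hD _ _).trans (le_max_right _ _)⟩
      have h₂ := congrArg (fun M => M.submatrix id F.pivot) (congrArg Matrix.transpose h₁)
      rw [Matrix.transpose_add, Matrix.transpose_mul, Matrix.transpose_transpose] at h₂
      exact h₂

end CUR

/-! ### Entrywise bounds for products -/

section Entrywise

variable {α β γ : Type*} [Fintype α]

theorem abs_dotProduct_mulVec_le [Fintype β] (M : Matrix α β ℝ) (u : α → ℝ) (v : β → ℝ) {B c : ℝ}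
    (hα : (Fintype.card α : ℝ) ≤ B) (hβ : (Fintype.card β : ℝ) ≤ B) (hc : 0 ≤ c)
    (h : ∀ i j, |u i| * |M i j| * |v j| ≤ c) : |u ⬝ᵥ M *ᵥ v| ≤ B ^ 2 * c := by
  have hB : 0 ≤ B := (Nat.cast_nonneg _).trans hα
  calc |u ⬝ᵥ M *ᵥ v| = |∑ i, ∑ j, u i * M i j * v j| := by
        simp only [dotProduct, Matrix.mulVec, Finset.mul_sum, mul_assoc]
    _ ≤ ∑ i, ∑ j, |u i * M i j * v j| :=
        (Finset.abs_sum_le_sum_abs _ _).trans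
          (Finset.sum_le_sum fun i _ => Finset.abs_sum_le_sum_abs _ _)
    _ ≤ ∑ _i : α, ∑ _j : β, c := by
        refine Finset.sum_le_sum fun i _ => Finset.sum_le_sum fun j _ => ?_
        rw [abs_mul, abs_mul]
        exact h i j
    _ = Fintype.card α * (Fintype.card β * c) := by simp
    _ ≤ B * (B * c) := by gcongr
    _ = B ^ 2 * c := by ring

theorem abs_mul_apply_le (M : Matrix γ α ℝ) (N : Matrix α β ℝ) {B c : ℝ}
    (hα : (Fintype.card α : ℝ) ≤ B) (hc : 0 ≤ c) (i : γ) (j : β)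
    (h : ∀ l, |M i l| * |N l j| ≤ c) : |(M * N) i j| ≤ B * c := by
  rw [Matrix.mul_apply]
  calc |∑ l, M i l * N l j| ≤ ∑ l, |M i l * N l j| := Finset.abs_sum_le_sum_abs _ _
    _ ≤ ∑ _l : α, c := Finset.sum_le_sum fun l _ => by rw [abs_mul]; exact h l
    _ = Fintype.card α * c := by simp
    _ ≤ B * c := by gcongr

end Entrywise

/-! ### The perturbed cross approximation -/

section CUR

variable {μ ν : Type*} [Fintype μ] [Fintype ν] [DecidableEq ν] {A : Matrix μ ν ℝ} {k : ℕ}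
  {I : Fin k → μ} {J : Fin k → ν} {ε B : ℝ}

/-- The error of a perturbed cross approximation: `z`, `a`, `b` are `sᵀ A t`, `sᵀ A(:, J)` and
`A(I, :) t` up to errors of order `ε`. -/
theorem CoreBounds.abs_sub_le (h : CoreBounds A I J ε B) (hB : 2 ≤ B)
    (hμ : (Fintype.card μ : ℝ) ≤ B) (hν : (Fintype.card ν : ℝ) ≤ B) (hk : (k : ℝ) ≤ B)
    {s : μ → ℝ} {t : ν → ℝ} {a b : Fin k → ℝ} {z : ℝ}
    (hs : ∀ i, |s i| ≤ B ^ 2) (ht : ∀ j, |t j| ≤ B ^ 2)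
    (ha : ∀ j, |a j - (s ᵥ* A) (J j)| ≤ ε * B) (hb : ∀ i, |b i - (A *ᵥ t) (I i)| ≤ ε * B)
    (hz : |z - s ⬝ᵥ A *ᵥ t| ≤ ε) :
    |z - a ⬝ᵥ (A.submatrix I J)⁻¹ *ᵥ b| ≤ ε * B ^ 16 := by
  obtain ⟨P, D, hA, hP, hD⟩ := h.cols
  obtain ⟨L, G, hAJ, hL, hG⟩ := h.rows
  have hε := h.nonneg
  have hu := h.isUnit_core
  have hinv := h.inv_le
  have hB0 : 0 ≤ B := by linarith
  have hB1 : 1 ≤ B := by linarith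
  have hk' : (Fintype.card (Fin k) : ℝ) ≤ B := by simpa using hk
  set N := A.submatrix I J with hN
  set M := N⁻¹ with hM
  set AI := A.submatrix I id with hAI
  set AJ := A.submatrix id J with hAJdef
  set DI := D.submatrix I id with hDI
  have hNM : N * M = 1 := Matrix.mul_nonsing_inv N hu
  have hMN : M * N = 1 := Matrix.nonsing_inv_mul N hu
  have hAIeq : AI = N * P + DI := congrArg (fun X => X.submatrix I id) hA
  -- Here and in `hV` the unbounded inverse survives only in a product with an error of size ε.
  have hH : M * AI = P + M * DI := by
    rw [hAIeq, Matrix.mul_add, ← Matrix.mul_assoc, hMN, Matrix.one_mul]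
  have hV : AJ * M = L + G * M := by
    rw [hAJ, Matrix.add_mul, Matrix.mul_assoc, hNM, Matrix.mul_one]
  have hpow : B ^ 2 + B * B ^ 3 ≤ B ^ 5 := by
    have h₁ : B ^ 2 ≤ B ^ 4 := pow_le_pow_right₀ hB1 (by norm_num)
    have h₂ : 2 * B ^ 4 ≤ B * B ^ 4 := by gcongr
    calc _ = B ^ 2 + B ^ 4 := by ring
      _ ≤ 2 * B ^ 4 := by linarith
      _ ≤ _ := h₂
      _ = _ := by ring
  have hHb : ∀ i j, |(M * AI) i j| ≤ B ^ 5 := fun i j => by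
    rw [hH, Matrix.add_apply]
    refine (abs_add_le _ _).trans (le_trans (add_le_add (hP i j) ?_) hpow)
    refine abs_mul_apply_le M DI hk' (by positivity) i j fun l => ?_
    calc |M i l| * |DI l j| ≤ |M i l| * ε := by gcongr; exact hD _ _
      _ = ε * |M i l| := mul_comm _ _
      _ ≤ B ^ 3 := hinv i l
  have hVb : ∀ i j, |(AJ * M) i j| ≤ B ^ 5 := fun i j => by
    rw [hV, Matrix.add_apply]
    refine (abs_add_le _ _).trans (le_trans (add_le_add (hL i j) ?_) hpow)
    refine abs_mul_apply_le G M hk' (by positivity) i j fun l => ?_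
    calc |G i l| * |M l j| ≤ ε * |M l j| := by gcongr; exact hG _ _
      _ ≤ B ^ 3 := hinv l j
  -- The main part AJ * P cancels, leaving only errors.
  have hS : A - AJ * M * AI = D - AJ * M * DI := by
    rw [Matrix.mul_assoc, hH, Matrix.mul_add, ← Matrix.mul_assoc]
    nth_rewrite 1 [hA]
    abel
  have hSb : ∀ i j, |(A - AJ * M * AI) i j| ≤ ε * B ^ 7 := fun i j => by
    rw [hS, Matrix.sub_apply]
    have h₁ : |(AJ * M * DI) i j| ≤ B * (B ^ 5 * ε) :=
      abs_mul_apply_le _ DI hk' (by positivity) i j fun l => by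
        gcongr
        · exact hVb i l
        · exact hD _ _
    have h₂ : (1 : ℝ) ≤ B ^ 6 := one_le_pow₀ hB1
    calc _ ≤ |D i j| + |(AJ * M * DI) i j| := abs_sub _ _
      _ ≤ ε + B * (B ^ 5 * ε) := add_le_add (hD i j) h₁
      _ = ε * (1 + B ^ 6) := by ring
      _ ≤ ε * (2 * B ^ 6) := by gcongr; linarith
      _ ≤ ε * (B * B ^ 6) := by gcongr
      _ = _ := by ring
  set ea := a - s ᵥ* AJ with hea
  set eb := b - AI *ᵥ t with heb
  have hea' : ∀ j, |ea j| ≤ ε * B := ha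
  have heb' : ∀ i, |eb i| ≤ ε * B := hb
  -- In the last term M stands alone between two errors of order ε: one tames M, the other remains
  -- as the final factor.
  have hid : z - a ⬝ᵥ M *ᵥ b = (z - s ⬝ᵥ A *ᵥ t) + s ⬝ᵥ (A - AJ * M * AI) *ᵥ t
      - ea ⬝ᵥ (M * AI) *ᵥ t - s ⬝ᵥ (AJ * M) *ᵥ eb - ea ⬝ᵥ M *ᵥ eb := by
    have h₁ : a = s ᵥ* AJ + ea := by rw [hea]; abel
    have h₂ : b = AI *ᵥ t + eb := by rw [heb]; abel
    clear_value ea eb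
    subst h₁ h₂
    simp only [Matrix.dotProduct_mulVec, Matrix.vecMul_sub, Matrix.add_vecMul,
      ← Matrix.vecMul_vecMul, add_dotProduct, dotProduct_add, sub_dotProduct]
    ring
  have t₁ : |s ⬝ᵥ (A - AJ * M * AI) *ᵥ t| ≤ B ^ 2 * (B ^ 2 * (ε * B ^ 7) * B ^ 2) :=
    abs_dotProduct_mulVec_le _ _ _ hμ hν (by positivity) fun i j => by
      gcongr
      · exact hs i
      · exact hSb i j
      · exact ht j
  have t₂ : |ea ⬝ᵥ (M * AI) *ᵥ t| ≤ B ^ 2 * (ε * B * B ^ 5 * B ^ 2) :=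
    abs_dotProduct_mulVec_le _ _ _ hk' hν (by positivity) fun i j => by
      gcongr
      · exact hea' i
      · exact hHb i j
      · exact ht j
  have t₃ : |s ⬝ᵥ (AJ * M) *ᵥ eb| ≤ B ^ 2 * (B ^ 2 * B ^ 5 * (ε * B)) :=
    abs_dotProduct_mulVec_le _ _ _ hμ hk' (by positivity) fun i j => by
      gcongr
      · exact hs i
      · exact hVb i j
      · exact heb' j
  have t₄ : |ea ⬝ᵥ M *ᵥ eb| ≤ B ^ 2 * (ε * B ^ 5) :=
    abs_dotProduct_mulVec_le _ _ _ hk' hk' (by positivity) fun i j => by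
      calc |ea i| * |M i j| * |eb j| ≤ (ε * B) * |M i j| * (ε * B) := by
            gcongr
            · exact hea' i
            · exact heb' j
        _ = ε * B ^ 2 * (ε * |M i j|) := by ring
        _ ≤ ε * B ^ 2 * B ^ 3 := by gcongr; exact hinv i j
        _ = _ := by ring
  have p : ∀ n ≤ 13, ε * B ^ n ≤ ε * B ^ 13 := fun n hn =>
    mul_le_mul_of_nonneg_left (pow_le_pow_right₀ hB1 hn) hε
  have p0 : ε ≤ ε * B ^ 13 := by simpa using p 0 (by norm_num)
  have p7 := p 7 (by norm_num)
  have p10 := p 10 (by norm_num)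
  -- Each of the five terms is at most ε B¹³, and 5 ≤ 2³ ≤ B³.
  have p16 : ε * (5 * B ^ 13) ≤ ε * B ^ 16 := by
    refine mul_le_mul_of_nonneg_left ?_ hε
    have h8 : (5 : ℝ) ≤ B ^ 3 := by
      calc (5 : ℝ) ≤ 2 ^ 3 := by norm_num
        _ ≤ B ^ 3 := by gcongr
    calc 5 * B ^ 13 ≤ B ^ 3 * B ^ 13 := by gcongr
      _ = _ := by ring
  rw [hid]
  have e₁ : B ^ 2 * (B ^ 2 * (ε * B ^ 7) * B ^ 2) = ε * B ^ 13 := by ring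
  have e₂ : B ^ 2 * (ε * B * B ^ 5 * B ^ 2) = ε * B ^ 10 := by ring
  have e₃ : B ^ 2 * (B ^ 2 * B ^ 5 * (ε * B)) = ε * B ^ 10 := by ring
  have e₄ : B ^ 2 * (ε * B ^ 5) = ε * B ^ 7 := by ring
  rw [e₁] at t₁
  rw [e₂] at t₂
  rw [e₃] at t₃
  rw [e₄] at t₄
  rw [abs_le] at hz t₁ t₂ t₃ t₄ ⊢
  constructor <;> linarith

end CUR

/-! ### From the node matrix to the kernel -/

section Kernel

variable {d : ℕ} {K : (Fin d → ℝ) → (Fin d → ℝ) → ℝ} {mX mY : Fin d → ℕ}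

theorem nodeMatrix_apply (k : GridIdx mX) (l : GridIdx mY) :
    nodeMatrix K mX mY k l = Real.sqrt (gridWeight mX k) * K (gridNode mX k) (gridNode mY l) *
      Real.sqrt (gridWeight mY l) := by
  simp [nodeMatrix, kernelMatrix]

theorem nodeMatrix_submatrix {k : ℕ} (I : Fin k → GridIdx mX) (J : Fin k → GridIdx mY) :
    (nodeMatrix K mX mY).submatrix I J =
      Matrix.diagonal (fun i => Real.sqrt (gridWeight mX (I i))) *
        kernelMatrix K (gridNode mX ∘ I) (gridNode mY ∘ J) *
        Matrix.diagonal (fun j => Real.sqrt (gridWeight mY (J j))) := by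
  ext i j
  simp [nodeMatrix_apply, kernelMatrix]

/-- Row and column scalings cancel in `aᵀ M⁻¹ b`. -/
theorem dotProduct_inv_mulVec_scale {n : Type*} [Fintype n] [DecidableEq n] (M : Matrix n n ℝ)
    {w v : n → ℝ} (hw : ∀ i, w i ≠ 0) (hv : ∀ i, v i ≠ 0) (a b : n → ℝ) :
    (fun j => a j * v j) ⬝ᵥ ((Matrix.diagonal w * M * Matrix.diagonal v)⁻¹ *ᵥ
      fun i => w i * b i) = a ⬝ᵥ (M⁻¹ *ᵥ b) := by
  have hwu : IsUnit (Matrix.diagonal w).det := by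
    rw [Matrix.det_diagonal]
    exact (Finset.prod_ne_zero_iff.2 fun i _ => hw i).isUnit
  have hvu : IsUnit (Matrix.diagonal v).det := by
    rw [Matrix.det_diagonal]
    exact (Finset.prod_ne_zero_iff.2 fun i _ => hv i).isUnit
  have hb : (fun i => w i * b i) = Matrix.diagonal w *ᵥ b := by
    ext i; simp [Matrix.mulVec_diagonal]
  have ha : (fun j => a j * v j) = a ᵥ* Matrix.diagonal v := by
    ext j; simp [Matrix.vecMul_diagonal]
  rw [hb, ha, ← Matrix.dotProduct_mulVec, Matrix.mulVec_mulVec, Matrix.mulVec_mulVec,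
    Matrix.mul_inv_rev, Matrix.mul_inv_rev, Matrix.mul_assoc, Matrix.mul_assoc, Matrix.mul_assoc,
    Matrix.nonsing_inv_mul _ hwu, Matrix.mul_one, ← Matrix.mul_assoc,
    Matrix.mul_nonsing_inv _ hvu, Matrix.one_mul]

/-- The Lagrange basis divided by the square roots of the weights. -/
noncomputable def scaledLagrange (m : Fin d → ℕ) (x : Fin d → ℝ) (k : GridIdx m) : ℝ :=
  gridLagrange m k x / Real.sqrt (gridWeight m k)

theorem abs_scaledLagrange_le {m : Fin d → ℕ} {x : Fin d → ℝ} (hx : x ∈ cube d) (k : GridIdx m) :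
    |scaledLagrange m x k| ≤ (gridCard m : ℝ) ^ 2 := by
  rw [scaledLagrange, abs_div, abs_of_pos (sqrt_gridWeight_pos k), div_eq_mul_inv, sq]
  have := sqrt_gridWeight_pos k
  gcongr
  · exact abs_gridLagrange_le k hx
  · exact inv_sqrt_gridWeight_le k

theorem scaledLagrange_gridNode {m : Fin d → ℕ} (k l : GridIdx m) :
    scaledLagrange m (gridNode m l) k =
      if k = l then (Real.sqrt (gridWeight m l))⁻¹ else 0 := by
  rw [scaledLagrange, gridLagrange_gridNode]
  split_ifs with h
  · rw [h, one_div]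
  · rw [zero_div]

theorem sum_gridLagrange_eq (x y : Fin d → ℝ) :
    ∑ k : GridIdx mX, ∑ l : GridIdx mY,
      gridLagrange mX k x * K (gridNode mX k) (gridNode mY l) * gridLagrange mY l y =
    scaledLagrange mX x ⬝ᵥ nodeMatrix K mX mY *ᵥ scaledLagrange mY y := by
  simp only [dotProduct, Matrix.mulVec, Finset.mul_sum, nodeMatrix_apply, scaledLagrange]
  refine Finset.sum_congr rfl fun k _ => Finset.sum_congr rfl fun l _ => ?_
  have h₁ := (sqrt_gridWeight_pos k).ne'
  have h₂ := (sqrt_gridWeight_pos l).ne'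
  field_simp

theorem scaledLagrange_gridNode_eq_single {m : Fin d → ℕ} (l : GridIdx m) :
    scaledLagrange m (gridNode m l) = Pi.single l (Real.sqrt (gridWeight m l))⁻¹ := by
  ext k
  rw [scaledLagrange_gridNode, Pi.single_apply]

theorem InterpolatesWithin.abs_sub_le {δ : ℝ} (h : InterpolatesWithin K mX mY δ)
    {x y : Fin d → ℝ} (hx : x ∈ cube d) (hy : y ∈ cube d) :
    |K x y - scaledLagrange mX x ⬝ᵥ nodeMatrix K mX mY *ᵥ scaledLagrange mY y| ≤ δ := by
  rw [← sum_gridLagrange_eq]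
  exact h x hx y hy

/-- With y a node, the scaled Lagrange vector has a single nonzero entry, so the interpolation bound
concerns one entry of sᵀA; multiplying by the root of the weight costs at most 4^d. -/
theorem InterpolatesWithin.abs_row_sub_le {δ : ℝ} (h : InterpolatesWithin K mX mY δ)
    {x : Fin d → ℝ} (hx : x ∈ cube d) (l : GridIdx mY) :
    |K x (gridNode mY l) * Real.sqrt (gridWeight mY l) -
      (scaledLagrange mX x ᵥ* nodeMatrix K mX mY) l| ≤ δ * 4 ^ d := by
  have h₁ := h.abs_sub_le hx (gridNode_mem_cube l)
  have hw := sqrt_gridWeight_pos l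
  rw [scaledLagrange_gridNode_eq_single, Matrix.dotProduct_mulVec, dotProduct_single] at h₁
  have h₂ : K x (gridNode mY l) * Real.sqrt (gridWeight mY l) -
      (scaledLagrange mX x ᵥ* nodeMatrix K mX mY) l =
      (K x (gridNode mY l) - (scaledLagrange mX x ᵥ* nodeMatrix K mX mY) l *
        (Real.sqrt (gridWeight mY l))⁻¹) * Real.sqrt (gridWeight mY l) := by
    field_simp
  rw [h₂, abs_mul, abs_of_pos hw]
  exact mul_le_mul h₁ (sqrt_gridWeight_le l) hw.le ((abs_nonneg _).trans h₁)

theorem InterpolatesWithin.abs_col_sub_le {δ : ℝ} (h : InterpolatesWithin K mX mY δ)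
    {y : Fin d → ℝ} (hy : y ∈ cube d) (k : GridIdx mX) :
    |Real.sqrt (gridWeight mX k) * K (gridNode mX k) y -
      (nodeMatrix K mX mY *ᵥ scaledLagrange mY y) k| ≤ δ * 4 ^ d := by
  have h₁ := h.abs_sub_le (gridNode_mem_cube k) hy
  have hw := sqrt_gridWeight_pos k
  rw [scaledLagrange_gridNode_eq_single, single_dotProduct] at h₁
  have h₂ : Real.sqrt (gridWeight mX k) * K (gridNode mX k) y -
      (nodeMatrix K mX mY *ᵥ scaledLagrange mY y) k =
      (K (gridNode mX k) y - (Real.sqrt (gridWeight mX k))⁻¹ *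
        (nodeMatrix K mX mY *ᵥ scaledLagrange mY y) k) * Real.sqrt (gridWeight mX k) := by
    field_simp
  rw [h₂, abs_mul, abs_of_pos hw]
  exact mul_le_mul h₁ (sqrt_gridWeight_le k) hw.le ((abs_nonneg _).trans h₁)

theorem CoreBounds.isUnit_kernelMatrix {k : ℕ} {I : Fin k → GridIdx mX} {J : Fin k → GridIdx mY}
    {ε B : ℝ} (h : CoreBounds (nodeMatrix K mX mY) I J ε B) :
    IsUnit (kernelMatrix K (gridNode mX ∘ I) (gridNode mY ∘ J)).det := by
  have hu := h.isUnit_core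
  rw [nodeMatrix_submatrix, Matrix.det_mul, Matrix.det_mul] at hu
  exact isUnit_of_mul_isUnit_right (isUnit_of_mul_isUnit_left hu)

theorem CoreBounds.abs_sub_skelApprox_le {k : ℕ} {I : Fin k → GridIdx mX}
    {J : Fin k → GridIdx mY} {ε δ B : ℝ} (h : CoreBounds (nodeMatrix K mX mY) I J ε B)
    (hK : InterpolatesWithin K mX mY δ) (hδ : δ ≤ ε) (hB : 2 ≤ B) (hd : 4 ^ d ≤ B)
    (hX : (gridCard mX : ℝ) ≤ B) (hY : (gridCard mY : ℝ) ≤ B) (hk : (k : ℝ) ≤ B)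
    {x y : Fin d → ℝ} (hx : x ∈ cube d) (hy : y ∈ cube d) :
    |K x y - skelApprox K (gridNode mX ∘ I) (gridNode mY ∘ J) x y| ≤ ε * B ^ 16 := by
  have hε := h.nonneg
  have hδB : δ * 4 ^ d ≤ ε * B := by gcongr
  have h₁ := h.abs_sub_le hB hX hY hk (s := scaledLagrange mX x) (t := scaledLagrange mY y)
    (a := fun j => K x (gridNode mY (J j)) * Real.sqrt (gridWeight mY (J j)))
    (b := fun i => Real.sqrt (gridWeight mX (I i)) * K (gridNode mX (I i)) y) (z := K x y)
    (fun i => (abs_scaledLagrange_le hx i).trans (by gcongr))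
    (fun j => (abs_scaledLagrange_le hy j).trans (by gcongr))
    (fun j => (hK.abs_row_sub_le hx (J j)).trans hδB)
    (fun i => (hK.abs_col_sub_le hy (I i)).trans hδB)
    ((hK.abs_sub_le hx hy).trans hδ)
  rw [nodeMatrix_submatrix, dotProduct_inv_mulVec_scale _ (fun i => (sqrt_gridWeight_pos (I i)).ne')
    (fun j => (sqrt_gridWeight_pos (J j)).ne')] at h₁
  exact h₁

end Kernel

/-- Polynomial growth, uniformly over the square `n, k ≤ r`. -/
theorem exists_polyVal_le (q : MvPolynomial (Fin 2) ℝ) :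
    ∃ (c : ℝ) (N : ℕ), 0 ≤ c ∧
      ∀ r n k : ℕ, n ≤ r → k ≤ r → |polyVal q n k| ≤ c * (1 + (r : ℝ)) ^ N := by
  induction q using MvPolynomial.induction_on with
  | C a => exact ⟨|a|, 0, abs_nonneg a, fun r n k _ _ => by simp [polyVal]⟩
  | add p q hp hq =>
    obtain ⟨c, N, hc, h⟩ := hp
    obtain ⟨c', N', hc', h'⟩ := hq
    refine ⟨c + c', N + N', by positivity, fun r n k hn hk => ?_⟩
    have hr : (1 : ℝ) ≤ 1 + r := by linarith [(Nat.cast_nonneg r : (0 : ℝ) ≤ r)]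
    have h₁ : |polyVal (p + q) n k| ≤ |polyVal p n k| + |polyVal q n k| := by
      simp only [polyVal, map_add]
      exact abs_add_le _ _
    refine h₁.trans ((add_le_add (h r n k hn hk) (h' r n k hn hk)).trans ?_)
    rw [add_mul]
    gcongr <;> first | exact hr | omega
  | mul_X p i hp =>
    obtain ⟨c, N, hc, h⟩ := hp
    refine ⟨c, N + 1, hc, fun r n k hn hk => ?_⟩
    have h₁ : |polyVal (p * MvPolynomial.X i) n k| = |polyVal p n k| * |![(n : ℝ), k] i| := by
      simp [polyVal, abs_mul]
    have h₂ : |![(n : ℝ), k] i| ≤ 1 + r := by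
      have hn' : (n : ℝ) ≤ r := by exact_mod_cast hn
      have hk' : (k : ℝ) ≤ r := by exact_mod_cast hk
      fin_cases i <;> simp <;> linarith
    rw [h₁, pow_succ, ← mul_assoc]
    exact mul_le_mul (h r n k hn hk) h₂ (abs_nonneg _) (by positivity)

end SkelInterp

/-! ### Choice of the polynomials and the constant -/

open SkelInterp in
theorem theorem2 (d : ℕ) (q₁ q₂ : MvPolynomial (Fin 2) ℝ) :
    ∃ (r r' : MvPolynomial (Fin 2) ℝ) (C : ℝ),
      ∀ (K : (Fin d → ℝ) → (Fin d → ℝ) → ℝ) (mX mY : Fin d → ℕ) (r₀ r₁ : ℕ) (ε δ : ℝ)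
        (I : Fin r₁ → GridIdx mX) (J : Fin r₁ → GridIdx mY),
        (∀ i, 0 < mX i) → (∀ i, 0 < mY i) →
        r₀ = max (gridCard mX) (gridCard mY) →
        InterpolatesWithin K mX mY δ → δ ≤ ε →
        IsStrongCUR q₁ q₂ (nodeMatrix K mX mY) I J ε →
        IsUnit (kernelMatrix K (gridNode mX ∘ I) (gridNode mY ∘ J)).det ∧
        ∀ x ∈ cube d, ∀ y ∈ cube d,
          |K x y - skelApprox K (gridNode mX ∘ I) (gridNode mY ∘ J) x y|
              ≤ C * (ε * polyVal r r₀ r₁) ∧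
          |K x y - skelApprox K (gridNode mX ∘ I) (gridNode mY ∘ J) x y|
              ≤ C * (singVal (nodeMatrix K mX mY) r₁ * polyVal r' r₀ r₁) := by
  obtain ⟨c₁, N₁, hc₁, h₁⟩ := exists_polyVal_le q₁
  obtain ⟨c₂, N₂, hc₂, h₂⟩ := exists_polyVal_le q₂
  -- Chosen so that B = c (1 + r₀)^N dominates 2, 4^d, both polynomials and, through the extra 1 in
  -- N, r₀ itself.
  set c : ℝ := 2 + 4 ^ d + c₁ + c₂ with hc
  set N : ℕ := N₁ + N₂ + 1 with hN
  have h4 : (0 : ℝ) < 4 ^ d := by positivity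
  clear_value c N
  -- The error is at most ε B¹⁶, and ε ≤ B σ_{r₁+1} costs one more B; the first estimate gives that
  -- factor away. As r₁ ≤ r₀, powers of 1 + r₀ suffice.
  refine ⟨(1 + MvPolynomial.X 0) ^ (N * 17), (1 + MvPolynomial.X 0) ^ (N * 17), c ^ 17, ?_⟩
  intro K mX mY r₀ r₁ ε δ I J _ _ hr₀ hK hδ hCUR
  have hρ : (1 : ℝ) ≤ 1 + r₀ := by linarith [(Nat.cast_nonneg r₀ : (0 : ℝ) ≤ r₀)]
  have hpoly : polyVal ((1 + MvPolynomial.X 0) ^ (N * 17)) r₀ r₁ = (1 + (r₀ : ℝ)) ^ (N * 17) := by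
    simp [polyVal]
  set B : ℝ := c * (1 + (r₀ : ℝ)) ^ N with hBdef
  have hle : ∀ (a : ℝ) (M : ℕ), 0 ≤ a → a ≤ c → M ≤ N → a * (1 + (r₀ : ℝ)) ^ M ≤ B := by
    intro a M ha hac hM
    rw [hBdef]
    gcongr
    exact ha.trans hac
  have hB : 2 ≤ B := by simpa using hle 2 0 (by norm_num) (by linarith) (by omega)
  have hd : (4 : ℝ) ^ d ≤ B := by simpa using hle (4 ^ d) 0 h4.le (by linarith) (by omega)
  have hr₀B : (r₀ : ℝ) ≤ B := by
    have := hle 1 1 zero_le_one (by linarith) (by omega)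
    linarith
  have hX : gridCard mX ≤ r₀ := hr₀ ▸ le_max_left _ _
  have hY : gridCard mY ≤ r₀ := hr₀ ▸ le_max_right _ _
  have hr₁ : r₁ ≤ r₀ := hCUR.le_card.trans hY
  have hr₀' : max (Fintype.card (GridIdx mX)) (Fintype.card (GridIdx mY)) = r₀ := hr₀.symm
  have hcore : CoreBounds (nodeMatrix K mX mY) I J ε B := by
    refine hCUR.coreBounds hB (fun n hn => ?_) fun n hn => ?_
    · exact (le_abs_self _).trans ((h₁ r₀ n r₁ (hn.trans_eq hr₀') hr₁).trans
        (hle _ _ hc₁ (by linarith) (by omega)))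
    · exact (le_abs_self _).trans ((h₂ r₀ n r₁ (hn.trans_eq hr₀') hr₁).trans
        (hle _ _ hc₂ (by linarith) (by omega)))
  have hε := hcore.nonneg
  have hB17 : B ^ 17 = c ^ 17 * (1 + (r₀ : ℝ)) ^ (N * 17) := by
    rw [hBdef, mul_pow, ← pow_mul]
  clear_value B
  refine ⟨hcore.isUnit_kernelMatrix, fun x hx y hy => ?_⟩
  have herr := hcore.abs_sub_skelApprox_le hK hδ hB hd
    ((Nat.cast_le.2 hX).trans hr₀B) ((Nat.cast_le.2 hY).trans hr₀B)
    ((Nat.cast_le.2 hr₁).trans hr₀B) hx hy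
  rw [hpoly]
  constructor
  · calc _ ≤ ε * B ^ 16 := herr
      _ ≤ ε * B ^ 17 := by
        gcongr
        · linarith
        · norm_num
      _ = _ := by rw [hB17, mul_left_comm]
  · calc _ ≤ ε * B ^ 16 := herr
      _ ≤ B * singVal (nodeMatrix K mX mY) r₁ * B ^ 16 := by
        gcongr
        exact hcore.le_singVal
      _ = singVal (nodeMatrix K mX mY) r₁ * B ^ 17 := by ring
      _ = _ := by rw [hB17, mul_left_comm]
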